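/- Let $D\subset\mathbb R^d$ be a bounded open set (the one-dimensional case $D\subset\mathbb R$ is included), let $T>0$, and let $\langle\cdot,\cdot\rangle$ be the scalar product of the real Hilbert space $L^2(D)$. Let $\mathcal L:D(\mathcal L)\subset L^2(D)\to L^2(D)$ be a densely defined, self-adjoint, positive linear operator with compact inverse, and let $(e_j)_{j\in\mathbb N}$ be an orthonormal basis of $L^2(D)$ with $e_j\in D(\mathcal L)$ and $\mathcal L e_j=\lambda_j e_j$. Let $Q$ be a bounded, self-adjoint, positive semidefinite operator on $L^2(D)$ with $Qe_j=\mu_je_j$ for all $j$ and $\operatorname{Tr}Q<\infty$, and let $W$ be an $L^2(D)$-valued $Q$-Wiener process on $[0,T]$ over a probability space $(\Omega,\mathcal F,\mathbb P)$. Put $B_j(t)=\mu_j^{-1/2}\langle W(t),e_j\rangle$ if $\mu_j>0$ and $B_j=0$ if $\mu_j=0$, so that $W(t)=\sum_j\sqrt{\mu_j}\,B_j(t)\,e_j$. Let $y_0\in L^2(D)$ be deterministic. For $s>0$ let $y(s)=\sum_j y_j(s,\cdot)e_j$ be the solution of $dy+\mathcal L^s y\,dt=dW$, $y(0)=y_0$;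 that is, $t\mapsto y_j(s,t)$ is the continuous solution on $[0,T]$ of the Itô equation $$dy_j=-\lambda_j^s\,y_j\,dt+\sqrt{\mu_j}\,dB_j,\qquad y_j(s,0)=\langle y_0,e_j\rangle .$$ Since the noise is additive, this equation is understood path by path, simultaneously for all $s>0$ on one event of full probability. Then, almost surely, for all $j$ and all $t\in[0,T]$ the function $s\mapsto y_j(s,t)$ is twice continuously differentiable on $(0,\infty)$, and for every $\bar s\in(0,\infty)$ the following holds. 1. The series $$\partial_s y(\bar s)=\sum_{j}\partial_s y_j(\bar s,\cdot)\,e_j\qquad\text{and}\qquad \partial_{ss}^2y(\bar s)=\sum_{j}\partial_{ss}^2y_j(\bar s,\cdot)\,e_j$$ converge in $L^2(\Omega,L^2(D\times[0,T]))$; in particular their sums belong to this space. 2. Almost surely, both series also converge in $L^2(D\times[0,T])$, to the values at $\omega$ of the sums in 1, and for $k=1,2$ $$\|\partial_s^k y(\bar s,\omega)\|^2_{L^2(D\times[0,T])}=\sum_j\int_0^T|\partial_s^k y_j(\bar s,t,\omega)|^2\,dt<\infty .$$ -/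

import Mathlib

open MeasureTheory ProbabilityTheory Filter Topology Set
open scoped ENNReal NNReal RealInnerProductSpace

noncomputable section

namespace FractionalSPDE

section Hilbert

variable {H : Type*} [NormedAddCommGroup H] [InnerProductSpace ℝ H] [CompleteSpace H]

/-- `L : D(L) ⊆ H → H` is densely defined, self-adjoint, positive and has a compact inverse `K`
(everywhere defined on `H`). -/
structure IsDiffusionOperator (L : H →ₗ.[ℝ] H) : Prop where
  dense_domain : Dense (L.domain : Set H)
  selfAdjoint : IsSelfAdjoint L
  positive : ∀ v : L.domain, v ≠ 0 → 0 < ⟪L v, (v : H)⟫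
  compact_inverse : ∃ K : H →L[ℝ] H, IsCompactOperator K ∧
    (∀ v : L.domain, K (L v) = v) ∧
    ∀ w : H, ∃ h : K w ∈ L.domain, L ⟨K w, h⟩ = w

/-- The orthonormal basis `e` consists of eigenvectors of `L`, with eigenvalues `lam`. -/
def IsEigenbasis (L : H →ₗ.[ℝ] H) (e : HilbertBasis ℕ ℝ H) (lam : ℕ → ℝ) : Prop :=
  ∀ j, ∃ h : e j ∈ L.domain, L ⟨e j, h⟩ = lam j • e j

/-- `Q` is a covariance operator which is diagonal in the basis `e`, with eigenvalues `mu`: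
bounded, self-adjoint, positive semidefinite and of finite trace. -/
structure IsCovariance (Q : H →L[ℝ] H) (e : HilbertBasis ℕ ℝ H) (mu : ℕ → ℝ) : Prop where
  isPositive : Q.IsPositive
  eigen : ∀ j, Q (e j) = mu j • e j
  finite_trace : Summable fun j => ⟪Q (e j), e j⟫

/-- `W` is an `H`-valued `Q`-Wiener process on `[0, T]` under `P`: it starts at `0`, has continuous
paths, independent increments, and `W t - W s` is centred Gaussian with covariance
`(t - s) Q`. -/
structure IsQWiener {Ω : Type*} [MeasurableSpace Ω] (P : Measure Ω) (T : ℝ) (Q : H →L[ℝ] H)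
    (W : Icc (0 : ℝ) T → Ω → H) : Prop where
  stronglyMeasurable : ∀ t, StronglyMeasurable (W t)
  zero : ∀ t : Icc (0 : ℝ) T, (t : ℝ) = 0 → ∀ᵐ ω ∂P, W t ω = 0
  continuous_paths : ∀ᵐ ω ∂P, Continuous fun t => W t ω
  indep_increments : letI : MeasurableSpace H := borel H; HasIndepIncrements W P
  gaussian_increments : ∀ s t : Icc (0 : ℝ) T, s ≤ t → ∀ h : H,
    P.map (fun ω => ⟪W t ω - W s ω, h⟫) =
      gaussianReal 0 (Real.toNNReal (((t : ℝ) - s) * ⟪Q h, h⟫))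

/-- The real Brownian motions `B_j(t) = ⟨W(t), e_j⟩ / √μ_j` of the expansion
`W(t) = ∑_j √μ_j B_j(t) e_j`. If `μ_j = 0`, then `⟨W(t), e_j⟩ = 0` almost surely, `B_j` is set to
zero, and it enters everything below only through the product `√μ_j B_j`. -/
def modeBM {Ω : Type*} {T : ℝ} (e : HilbertBasis ℕ ℝ H) (mu : ℕ → ℝ)
    (W : Icc (0 : ℝ) T → Ω → H) (j : ℕ) (t : Icc (0 : ℝ) T) (ω : Ω) : ℝ :=
  ⟪W t ω, e j⟫ / √(mu j)

/-- `y j s t ω` is the family of modes `y_j(s, t) = ⟨y(s)(t), e_j⟩` of the solution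
`y(s) = ∑_j y_j(s, ·) e_j` of `dy + L^s y dt = dW`, `y(0) = y₀`. For every exponent `s > 0` and every
`j`, the process `t ↦ y j s t` is continuous on `[0, T]` and solves the Itô equation
`dy_j = - λ_j^s y_j dt + √μ_j dB_j`, `y_j(0) = ⟨y₀, e_j⟩`.

The noise is additive, so the integrated equation makes sense, and is uniquely solvable, path by
path. The solutions for different `s` are taken on one common event of full probability, so that
`s ↦ y j s t ω` may be differentiated. -/
def IsModeSolution {Ω : Type*} [MeasurableSpace Ω] (P : Measure Ω) (T : ℝ)
    (e : HilbertBasis ℕ ℝ H) (lam mu : ℕ → ℝ) (W : Icc (0 : ℝ) T → Ω → H) (y₀ : H)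
    (y : ℕ → ℝ → ℝ → Ω → ℝ) : Prop :=
  ∀ᵐ ω ∂P, ∀ j, ∀ s : ℝ, 0 < s →
    ContinuousOn (fun t => y j s t ω) (Icc 0 T) ∧
    ∀ t : Icc (0 : ℝ) T,
      y j s t ω = ⟪y₀, e j⟫ - (∫ τ in (0 : ℝ)..t, lam j ^ s * y j s τ ω)
        + √(mu j) * modeBM e mu W j t ω

end Hilbert

section Space

variable {E : Type*} [NormedAddCommGroup E] [InnerProductSpace ℝ E] [FiniteDimensional ℝ E]
  [MeasurableSpace E] [BorelSpace E]

/-- The real Hilbert space `L²(D)`. -/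
abbrev L2D (D : Set E) : Type _ := Lp ℝ 2 (volume.restrict D)

/-- Lebesgue measure on `D × [0, T]`. -/
def cylMeasure (D : Set E) (T : ℝ) : Measure (E × ℝ) :=
  (volume.restrict D).prod (volume.restrict (Icc (0 : ℝ) T))

/-- The real Hilbert space `L²(D × [0, T])`. -/
abbrev L2DT (D : Set E) (T : ℝ) : Type _ := Lp ℝ 2 (cylMeasure D T)

/-- The `k`-th derivative `∂_s^k y_j(s, t)` of a mode with respect to the exponent. -/
def modeDeriv {Ω : Type*} (y : ℕ → ℝ → ℝ → Ω → ℝ) (k j : ℕ) (s t : ℝ) (ω : Ω) : ℝ :=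
  iteratedDeriv k (fun r => y j r t ω) s

end Space

end FractionalSPDE

end

/-!
The noise is additive, so integration by parts removes the stochastic integral: with `a = λ_j ^ s`,
`c = ⟪y₀, e_j⟫` and `g = √μ_j B_j`,
`y_j(s, t) = (c + g(t)) e^{-at} - ∫₀ᵗ a e^{-ar} (g(t - r) - g(t)) dr`,
which is smooth in `s` path by path. Since `a = exp (s log λ_j)`, the operator `∂_s` is
`log λ_j · a d/da`, and `(a d/da)^k` turns the kernels `e^{-ar}` and `a e^{-ar}` into a polynomial
in `ar` times themselves. The increments of `g` have second moments at most `μ_j |t - s|`, so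
`𝔼 ∫₀ᵀ |∂_s^k y_j|² dt ≤ C_k (log λ_j)^{2k} λ_j^{-s} (c² + μ_j T)`. The `λ_j` are bounded away from
zero, hence the factor involving `λ_j` is bounded, and the right-hand side is summable because
`y₀ ∈ L²` and `∑ μ_j < ∞`. The terms `∂_s^k y_j e_j` are pairwise orthogonal for every `ω`, and for
an orthogonal series summability of the squared norms, either in mean or at a fixed `ω`, is
convergence.
-/

noncomputable section

open scoped Polynomial Nat

namespace FractionalSPDE

section Kernel

/-- The polynomial `P` with `(x d/dx)ᵏ (xⁿ e⁻ˣ) = xⁿ P(x) e⁻ˣ`. -/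
def eulerPoly (n : ℕ) : ℕ → ℝ[X]
  | 0 => 1
  | k + 1 =>
    (n : ℝ[X]) * eulerPoly n k + Polynomial.X * ((eulerPoly n k).derivative - eulerPoly n k)

/-- The image of `a ↦ aⁿ e^{-a r}` under the `k`-th power of the Euler operator `a d/da`. The
semigroup `e^{-a r}` is the case `n = 0`, the kernel `a e^{-a r}` the case `n = 1`. -/
def expKernel (n k : ℕ) (a r : ℝ) : ℝ :=
  a ^ n * (eulerPoly n k).eval (a * r) * Real.exp (-(a * r))

/-- A constant for the bound `abs_expKernel_le`, which trades half of the exponential for the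
polynomial factor by `xⁱ ≤ 2ⁱ i! e^{x/2}`. -/
def expKernelBound (n k : ℕ) : ℝ :=
  (eulerPoly n k).sum fun i c => |c| * (2 ^ i * i !)

variable (n k : ℕ)

lemma continuous_expKernel : Continuous (expKernel n k).uncurry :=
  ((continuous_fst.pow n).mul
    ((eulerPoly n k).continuous.comp (continuous_fst.mul continuous_snd))).mul
      (continuous_fst.mul continuous_snd).neg.rexp

lemma hasDerivAt_expKernel_exp (r x : ℝ) :
    HasDerivAt (fun x => expKernel n k (Real.exp x) r) (expKernel n (k + 1) (Real.exp x) r) x := by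
  have h_mul : HasDerivAt (fun x => Real.exp x * r) (Real.exp x * r) x :=
    (Real.hasDerivAt_exp x).mul_const r
  have h_pow : HasDerivAt (fun x => Real.exp x ^ n) (n * Real.exp x ^ n) x := by
    simp only [← Real.exp_nat_mul]
    exact ((hasDerivAt_id' x).const_mul (n : ℝ)).exp.congr_deriv (by ring)
  have h_poly := ((eulerPoly n k).hasDerivAt (Real.exp x * r)).comp x h_mul
  refine ((h_pow.fun_mul h_poly).fun_mul h_mul.fun_neg.exp).congr_deriv ?_
  simp only [expKernel, eulerPoly, Function.comp_apply, Polynomial.eval_add, Polynomial.eval_mul,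
    Polynomial.eval_sub, Polynomial.eval_X, Polynomial.eval_natCast]
  ring

lemma expKernelBound_nonneg : 0 ≤ expKernelBound n k :=
  Finset.sum_nonneg fun _ _ => by positivity

lemma pow_le_mul_exp_half (i : ℕ) {x : ℝ} (hx : 0 ≤ x) :
    x ^ i ≤ 2 ^ i * i ! * Real.exp (x / 2) := by
  have h := Real.pow_div_factorial_le_exp (x / 2) (by positivity) i
  rw [div_pow, div_div, div_le_iff₀ (by positivity)] at h
  linarith

lemma abs_expKernel_le {a r : ℝ} (ha : 0 ≤ a) (hr : 0 ≤ r) :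
    |expKernel n k a r| ≤ expKernelBound n k * (a ^ n * Real.exp (-(a / 2 * r))) := by
  have h_poly : |(eulerPoly n k).eval (a * r)| ≤ expKernelBound n k * Real.exp (a * r / 2) := by
    rw [Polynomial.eval_eq_sum, expKernelBound, Polynomial.sum, Polynomial.sum, Finset.sum_mul]
    refine (Finset.abs_sum_le_sum_abs _ _).trans (Finset.sum_le_sum fun i _ => ?_)
    rw [abs_mul, abs_of_nonneg (by positivity : 0 ≤ (a * r) ^ i), mul_assoc]
    exact mul_le_mul_of_nonneg_left (pow_le_mul_exp_half i (by positivity)) (abs_nonneg _)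
  calc |expKernel n k a r|
      = a ^ n * |(eulerPoly n k).eval (a * r)| * Real.exp (-(a * r)) := by
        rw [expKernel, abs_mul, abs_mul, Real.abs_exp, abs_of_nonneg (by positivity : 0 ≤ a ^ n)]
    _ ≤ a ^ n * (expKernelBound n k * Real.exp (a * r / 2)) * Real.exp (-(a * r)) := by gcongr
    _ = expKernelBound n k * (a ^ n * Real.exp (-(a / 2 * r))) := by
        rw [show -(a / 2 * r) = a * r / 2 + -(a * r) by ring, Real.exp_add]
        ring

end Kernel

section Volterra

/-- The image of `a ↦ y(t)` under the `k`-th power of the Euler operator `a d/da`, where `y` is the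
solution of the Volterra equation `y(t) = c - a ∫₀ᵗ y(τ) dτ + g(t)`. The increments of the forcing
`g` in the convolution are what remains of a stochastic integral after integration by parts. -/
def volterraDeriv (c : ℝ) (g : ℝ → ℝ) (k : ℕ) (a t : ℝ) : ℝ :=
  (c + g t) * expKernel 0 k a t - ∫ r in (0 : ℝ)..t, expKernel 1 k a r * (g (t - r) - g t)

lemma intervalIntegrable_of_continuousOn_Icc {f : ℝ → ℝ} {t : ℝ} (ht : 0 ≤ t)
    (hf : ContinuousOn f (Icc 0 t)) : IntervalIntegrable f volume 0 t :=
  ContinuousOn.intervalIntegrable (by rwa [uIcc_of_le ht])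

/- Integrating the derivative of `e^{-a (t - x)} (A x - c - g t)`, which involves `g` only through
`g x - g t`. -/
lemma integral_exp_mul_sub_of_hasDerivAt {a c t : ℝ} {g A : ℝ → ℝ} (ht : 0 ≤ t)
    (hg : ContinuousOn g (Icc 0 t)) (hA : ContinuousOn A (Icc 0 t))
    (hA' : ∀ x ∈ Ioo 0 t, HasDerivAt A (a * (c - A x + g x)) x) :
    ∫ τ in (0 : ℝ)..t, a * Real.exp (-(a * (t - τ))) * (g τ - g t) =
      (A t - (c + g t)) - Real.exp (-(a * t)) * (A 0 - (c + g t)) := by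
  have h_deriv (x : ℝ) (hx : x ∈ Ioo 0 t) :
      HasDerivAt (fun x => Real.exp (-(a * (t - x))) * (A x - (c + g t)))
        (a * Real.exp (-(a * (t - x))) * (g x - g t)) x := by
    have h_exp : HasDerivAt (fun x => Real.exp (-(a * (t - x))))
        (a * Real.exp (-(a * (t - x)))) x :=
      ((((hasDerivAt_id' x).const_sub t).const_mul a).fun_neg.exp).congr_deriv (by ring)
    exact (h_exp.fun_mul ((hA' x hx).sub_const (c + g t))).congr_deriv (by ring)
  rw [intervalIntegral.integral_eq_sub_of_hasDerivAt_of_le ht (by fun_prop) h_deriv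
    (intervalIntegrable_of_continuousOn_Icc ht (by fun_prop))]
  simp

lemma eq_volterraDeriv_zero {T a c : ℝ} {y g : ℝ → ℝ} (hg : ContinuousOn g (Icc 0 T))
    (hy : ContinuousOn y (Icc 0 T))
    (h : ∀ t ∈ Icc (0 : ℝ) T, y t = c - (∫ τ in (0 : ℝ)..t, a * y τ) + g t)
    {t : ℝ} (ht : t ∈ Icc (0 : ℝ) T) : y t = volterraDeriv c g 0 a t := by
  have h_sub : Icc 0 t ⊆ Icc 0 T := Icc_subset_Icc_right ht.2
  have hay : ContinuousOn (fun τ => a * y τ) (Icc 0 T) := continuousOn_const.mul hy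
  set A : ℝ → ℝ := fun x => ∫ τ in (0 : ℝ)..x, a * y τ
  have hA_cont : ContinuousOn A (Icc 0 t) := by
    rw [← uIcc_of_le ht.1]
    refine intervalIntegral.continuousOn_primitive_interval ?_
    rw [uIcc_of_le ht.1]
    exact (hay.mono h_sub).integrableOn_Icc
  have hA_deriv (x : ℝ) (hx : x ∈ Ioo 0 t) : HasDerivAt A (a * (c - A x + g x)) x := by
    have h_nhds : Icc 0 T ∈ 𝓝 x := Icc_mem_nhds hx.1 (hx.2.trans_le ht.2)
    rw [← h x (h_sub (Ioo_subset_Icc_self hx))]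
    exact intervalIntegral.integral_hasDerivAt_right
      (intervalIntegrable_of_continuousOn_Icc hx.1.le
        (hay.mono (Icc_subset_Icc_right (hx.2.le.trans ht.2))))
      ((hay.mono Ioo_subset_Icc_self).stronglyMeasurableAtFilter isOpen_Ioo x
        ⟨hx.1, hx.2.trans_le ht.2⟩)
      (hay.continuousAt h_nhds)
  have h_reflect := intervalIntegral.integral_comp_sub_left (a := 0) (b := t)
    (fun τ => a * Real.exp (-(a * (t - τ))) * (g τ - g t)) t
  simp only [sub_sub_cancel, sub_self, sub_zero] at h_reflect
  simp only [volterraDeriv, expKernel, eulerPoly, pow_zero, pow_one, one_mul, mul_one,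
    Polynomial.eval_one, h_reflect, h t ht,
    integral_exp_mul_sub_of_hasDerivAt ht.1 (hg.mono h_sub) hA_cont hA_deriv]
  simp only [A, intervalIntegral.integral_same]
  ring

lemma hasDerivAt_intervalIntegral_of_continuous {F F' : ℝ → ℝ → ℝ}
    (hF : ∀ x, Continuous (F x)) (hF' : Continuous F'.uncurry)
    (h_deriv : ∀ x r, HasDerivAt (fun x => F x r) (F' x r) x) (a b x : ℝ) :
    HasDerivAt (fun x => ∫ r in a..b, F x r) (∫ r in a..b, F' x r) x := by
  obtain ⟨C, hC⟩ :=
    ((isCompact_closedBall x 1).prod (isCompact_uIcc (a := a) (b := b))).bddAbove_image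
      hF'.norm.continuousOn
  refine (intervalIntegral.hasDerivAt_integral_of_dominated_loc_of_deriv_le
    (bound := fun _ => C) (Metric.closedBall_mem_nhds x one_pos)
    (Eventually.of_forall fun z => (hF z).aestronglyMeasurable) ((hF x).intervalIntegrable _ _)
    (hF'.uncurry_left x).aestronglyMeasurable (Eventually.of_forall fun r hr z hz => ?_)
    intervalIntegrable_const (Eventually.of_forall fun r _ z _ => h_deriv z r)).2
  exact hC ⟨(z, r), ⟨hz, uIoc_subset_uIcc hr⟩, rfl⟩

variable {g : ℝ → ℝ} (c : ℝ) (k : ℕ)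

lemma continuous_volterraDeriv (hg : Continuous g) (a : ℝ) :
    Continuous (volterraDeriv c g k a) := by
  have h_kernel (n : ℕ) : Continuous (expKernel n k a) := (continuous_expKernel n k).uncurry_left a
  refine ((continuous_const.add hg).mul (h_kernel 0)).sub
    (intervalIntegral.continuous_parametric_intervalIntegral_of_continuous (f := fun t r =>
      expKernel 1 k a r * (g (t - r) - g t)) ?_ continuous_id)
  exact ((h_kernel 1).comp continuous_snd).mul (by fun_prop)

lemma hasDerivAt_volterraDeriv_exp (hg : Continuous g) (t x : ℝ) :
    HasDerivAt (fun x => volterraDeriv c g k (Real.exp x) t)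
      (volterraDeriv c g (k + 1) (Real.exp x) t) x := by
  have h_cont (k : ℕ) :
      Continuous (fun x r => expKernel 1 k (Real.exp x) r * (g (t - r) - g t)).uncurry :=
    ((continuous_expKernel 1 k).comp
      ((Real.continuous_exp.comp continuous_fst).prodMk continuous_snd)).mul (by fun_prop)
  exact ((hasDerivAt_expKernel_exp 0 k t x).const_mul (c + g t)).sub
    (hasDerivAt_intervalIntegral_of_continuous (fun x => (h_cont k).uncurry_left x)
      (h_cont (k + 1)) (fun x r => (hasDerivAt_expKernel_exp 1 k r x).mul_const _) 0 t x)

lemma iteratedDeriv_volterraDeriv_exp (hg : Continuous g) (t : ℝ) :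
    iteratedDeriv k (fun x => volterraDeriv c g 0 (Real.exp x) t) =
      fun x => volterraDeriv c g k (Real.exp x) t := by
  induction k with
  | zero => exact iteratedDeriv_zero
  | succ k ih =>
    rw [iteratedDeriv_succ, ih]
    exact funext fun x => (hasDerivAt_volterraDeriv_exp c k hg t x).deriv

lemma contDiff_volterraDeriv_exp (hg : Continuous g) (t : ℝ) :
    ContDiff ℝ (⊤ : ℕ∞) fun x => volterraDeriv c g 0 (Real.exp x) t :=
  contDiff_of_differentiable_iteratedDeriv fun m _ => by
    rw [iteratedDeriv_volterraDeriv_exp c m hg t]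
    exact fun x => (hasDerivAt_volterraDeriv_exp c m hg t x).differentiableAt

variable {l : ℝ} (hl : 0 < l)
include hl

lemma contDiff_volterraDeriv_rpow (hg : Continuous g) (t : ℝ) :
    ContDiff ℝ (⊤ : ℕ∞) fun s : ℝ => volterraDeriv c g 0 (l ^ s) t := by
  simp only [Real.rpow_def_of_pos hl]
  exact (contDiff_volterraDeriv_exp c hg t).comp (contDiff_const.mul contDiff_id)

lemma iteratedDeriv_volterraDeriv_rpow (hg : Continuous g) (t : ℝ) :
    iteratedDeriv k (fun s : ℝ => volterraDeriv c g 0 (l ^ s) t) =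
      fun s => Real.log l ^ k * volterraDeriv c g k (l ^ s) t := by
  simp only [Real.rpow_def_of_pos hl]
  have h_smooth : ContDiff ℝ k fun x => volterraDeriv c g 0 (Real.exp x) t :=
    (contDiff_volterraDeriv_exp c hg t).of_le (by exact_mod_cast le_top)
  rw [iteratedDeriv_comp_const_mul h_smooth, iteratedDeriv_volterraDeriv_exp c k hg t]

end Volterra

section Moments

lemma enorm_add_sq_le (a b : ℝ) : ‖a + b‖ₑ ^ 2 ≤ 2 * (‖a‖ₑ ^ 2 + ‖b‖ₑ ^ 2) := by
  simp only [Real.enorm_eq_ofReal_abs]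
  rw [← ENNReal.ofReal_pow (abs_nonneg _), ← ENNReal.ofReal_pow (abs_nonneg _),
    ← ENNReal.ofReal_pow (abs_nonneg _), ← ENNReal.ofReal_add (by positivity) (by positivity),
    ← ENNReal.ofReal_ofNat 2, ← ENNReal.ofReal_mul (by norm_num)]
  simp only [sq_abs]
  exact ENNReal.ofReal_le_ofReal add_sq_le

variable {α Ω : Type*} [MeasurableSpace α] [MeasurableSpace Ω] {μ : Measure α} {P : Measure Ω}

lemma enorm_integral_mul_sq_le {κ h : α → ℝ} (hκ : AEMeasurable κ μ) (hh : AEMeasurable h μ) :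
    ‖∫ x, κ x * h x ∂μ‖ₑ ^ 2 ≤ (∫⁻ x, ‖κ x‖ₑ ∂μ) * ∫⁻ x, ‖κ x‖ₑ * ‖h x‖ₑ ^ 2 ∂μ := by
  have h_sqrt (z : ℝ≥0∞) : (z ^ (1 / 2 : ℝ)) ^ 2 = z := by
    rw [← ENNReal.rpow_natCast, ← ENNReal.rpow_mul]
    norm_num
  have h_holder := ENNReal.lintegral_mul_le_Lp_mul_Lq μ Real.HolderConjugate.two_two
    (hκ.enorm.pow_const (1 / 2 : ℝ)) ((hκ.enorm.pow_const (1 / 2 : ℝ)).mul hh.enorm)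
  simp only [Pi.mul_apply, ← mul_assoc, ENNReal.rpow_two, mul_pow, h_sqrt, ← pow_two] at h_holder
  calc ‖∫ x, κ x * h x ∂μ‖ₑ ^ 2 ≤ (∫⁻ x, ‖κ x‖ₑ * ‖h x‖ₑ ∂μ) ^ 2 := by
        gcongr
        simpa only [enorm_mul] using enorm_integral_le_lintegral_enorm (fun x => κ x * h x)
    _ ≤ _ := by
        rw [← h_sqrt (∫⁻ x, ‖κ x‖ₑ ∂μ), ← h_sqrt (∫⁻ x, ‖κ x‖ₑ * ‖h x‖ₑ ^ 2 ∂μ), ← mul_pow]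
        gcongr

lemma lintegral_enorm_integral_mul_sq_le [SFinite μ] [SFinite P] {κ : α → ℝ} {h : α → Ω → ℝ}
    (hκ : Measurable κ) (hh : Measurable h.uncurry) :
    ∫⁻ ω, ‖∫ x, κ x * h x ω ∂μ‖ₑ ^ 2 ∂P ≤
      (∫⁻ x, ‖κ x‖ₑ ∂μ) * ∫⁻ x, ‖κ x‖ₑ * ∫⁻ ω, ‖h x ω‖ₑ ^ 2 ∂P ∂μ := by
  have h_sq : Measurable fun p : Ω × α => ‖κ p.2‖ₑ * ‖h p.2 p.1‖ₑ ^ 2 :=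
    (hκ.comp measurable_snd).enorm.mul ((hh.comp measurable_swap).enorm.pow_const 2)
  calc ∫⁻ ω, ‖∫ x, κ x * h x ω ∂μ‖ₑ ^ 2 ∂P
      ≤ ∫⁻ ω, (∫⁻ x, ‖κ x‖ₑ ∂μ) * ∫⁻ x, ‖κ x‖ₑ * ‖h x ω‖ₑ ^ 2 ∂μ ∂P :=
        lintegral_mono fun ω =>
          enorm_integral_mul_sq_le hκ.aemeasurable hh.of_uncurry_right.aemeasurable
    _ = (∫⁻ x, ‖κ x‖ₑ ∂μ) * ∫⁻ x, ‖κ x‖ₑ * ∫⁻ ω, ‖h x ω‖ₑ ^ 2 ∂P ∂μ := by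
        rw [lintegral_const_mul _ h_sq.lintegral_prod_right',
          lintegral_lintegral_swap h_sq.aemeasurable]
        simp only [lintegral_const_mul _ (hh.of_uncurry_left.enorm.pow_const 2)]

lemma lintegral_pow_mul_exp_neg {b : ℝ} (hb : 0 < b) (i : ℕ) :
    ∫⁻ r in Ioi 0, ENNReal.ofReal (r ^ i * Real.exp (-(b * r))) =
      ENNReal.ofReal (i ! / b ^ (i + 1)) := by
  have h_value : ∫ r in Ioi (0 : ℝ), r ^ i * Real.exp (-(b * r)) = i ! / b ^ (i + 1) := by
    have := Real.integral_rpow_mul_exp_neg_mul_Ioi (a := i + 1) (r := b) (by positivity) hb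
    simp only [add_sub_cancel_right, Real.rpow_natCast] at this
    rw [this, Real.Gamma_nat_eq_factorial, ← Nat.cast_add_one, Real.rpow_natCast, one_div, inv_pow]
    ring
  rw [← h_value, ofReal_integral_eq_lintegral_ofReal]
  · by_contra h_not
    rw [integral_undef h_not] at h_value
    exact absurd h_value (by positivity)
  · filter_upwards [ae_restrict_mem measurableSet_Ioi] with r (hr : 0 < r)
    positivity

lemma lintegral_enorm_expKernel_mul_le {a : ℝ} (ha : 0 < a) (n k i : ℕ) :
    ∫⁻ r in Ioi 0, ‖expKernel n k a r‖ₑ * ENNReal.ofReal (r ^ i) ≤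
      ENNReal.ofReal (expKernelBound n k * (a ^ n * (i ! / (a / 2) ^ (i + 1)))) := by
  have h_const : 0 ≤ expKernelBound n k * a ^ n :=
    mul_nonneg (expKernelBound_nonneg n k) (by positivity)
  rw [← mul_assoc, ENNReal.ofReal_mul h_const, ← lintegral_pow_mul_exp_neg (half_pos ha),
    ← lintegral_const_mul _ (by fun_prop)]
  refine setLIntegral_mono (by fun_prop) fun r (hr : 0 < r) => ?_
  rw [Real.enorm_eq_ofReal_abs, ← ENNReal.ofReal_mul (abs_nonneg _), ← ENNReal.ofReal_mul h_const]
  refine ENNReal.ofReal_le_ofReal ?_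
  calc |expKernel n k a r| * r ^ i
      ≤ expKernelBound n k * (a ^ n * Real.exp (-(a / 2 * r))) * r ^ i := by
        gcongr
        exact abs_expKernel_le n k ha.le hr.le
    _ = _ := by ring

end Moments

section Noise

variable {Ω : Type*} [MeasurableSpace Ω]

/-- A real process on `[0, T]` which starts at zero, has continuous paths, and whose increments have
second moment at most `m (t - s)`, as do those of `√m B` for a Brownian motion `B`. Independence of
the increments is not required. -/
structure IsSubBrownian (P : Measure Ω) (T : ℝ) (m : ℝ≥0∞) (g : Icc (0 : ℝ) T → Ω → ℝ) :
    Prop where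
  measurable : ∀ t, Measurable (g t)
  zero : ∀ t : Icc (0 : ℝ) T, (t : ℝ) = 0 → ∀ᵐ ω ∂P, g t ω = 0
  continuous_paths : ∀ᵐ ω ∂P, Continuous fun t => g t ω
  lintegral_sub_sq_le : ∀ s t : Icc (0 : ℝ) T, s ≤ t →
    ∫⁻ ω, ‖g t ω - g s ω‖ₑ ^ 2 ∂P ≤ m * ENNReal.ofReal ((t : ℝ) - s)

namespace IsSubBrownian

variable {P : Measure Ω} {T : ℝ} {m : ℝ≥0∞} {g : Icc (0 : ℝ) T → Ω → ℝ}

lemma const_mul (hg : IsSubBrownian P T m g) {c : ℝ} (hc : ‖c‖ₑ ≤ 1) :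
    IsSubBrownian P T m fun t ω => c * g t ω where
  measurable t := (hg.measurable t).const_mul c
  zero t ht := by filter_upwards [hg.zero t ht] with ω hω using by rw [hω, mul_zero]
  continuous_paths := by
    filter_upwards [hg.continuous_paths] with ω hω using continuous_const.mul hω
  lintegral_sub_sq_le s t hst := by
    refine (lintegral_mono fun ω => ?_).trans (hg.lintegral_sub_sq_le s t hst)
    rw [← mul_sub, enorm_mul]
    gcongr
    exact mul_le_of_le_one_left' hc

lemma congr (hg : IsSubBrownian P T m g) {h : Icc (0 : ℝ) T → Ω → ℝ} (hh : ∀ t, Measurable (h t))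
    (h_eq : ∀ᵐ ω ∂P, ∀ t, h t ω = g t ω) : IsSubBrownian P T m h where
  measurable := hh
  zero t ht := by filter_upwards [hg.zero t ht, h_eq] with ω hω h_eq using by rw [h_eq, hω]
  continuous_paths := by
    filter_upwards [hg.continuous_paths, h_eq] with ω hω h_eq using by simpa only [h_eq] using hω
  lintegral_sub_sq_le s t hst := by
    refine (lintegral_congr_ae ?_).trans_le (hg.lintegral_sub_sq_le s t hst)
    filter_upwards [h_eq] with ω h_eq using by rw [h_eq, h_eq]

lemma exists_modification (hg : IsSubBrownian P T m g) (hT : 0 ≤ T) :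
    ∃ G : ℝ → Ω → ℝ, (∀ ω, Continuous fun t => G t ω) ∧ (∀ t, Measurable (G t)) ∧
      IsSubBrownian P T m (fun t => G t) ∧ ∀ᵐ ω ∂P, ∀ t : Icc (0 : ℝ) T, G t ω = g t ω := by
  obtain ⟨A, hA, hA_meas, h_cont⟩ := hg.continuous_paths.exists_measurable_mem
  let G (t : ℝ) : Ω → ℝ := A.indicator (g (projIcc 0 T hT t))
  have hG_eq : ∀ᵐ ω ∂P, ∀ t : Icc (0 : ℝ) T, G t ω = g t ω := by
    filter_upwards [hA] with ω hω t
    simp only [G, indicator_of_mem hω, projIcc_val]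
  have hG_meas (t : ℝ) : Measurable (G t) := (hg.measurable _).indicator hA_meas
  refine ⟨G, fun ω => ?_, hG_meas, hg.congr (fun t => hG_meas t) hG_eq, hG_eq⟩
  by_cases hω : ω ∈ A
  · simp only [G, indicator_of_mem hω]
    exact (h_cont ω hω).comp continuous_projIcc
  · simp only [G, indicator_of_notMem hω]
    exact continuous_const

variable {G : ℝ → Ω → ℝ}

lemma lintegral_sub_sq_le_of_mem_Icc (hG : IsSubBrownian P T m fun t => G t) {s t : ℝ}
    (hs : 0 ≤ s) (hst : s ≤ t) (ht : t ≤ T) :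
    ∫⁻ ω, ‖G t ω - G s ω‖ₑ ^ 2 ∂P ≤ m * ENNReal.ofReal (t - s) :=
  hG.lintegral_sub_sq_le ⟨s, hs, hst.trans ht⟩ ⟨t, hs.trans hst, ht⟩ hst

lemma lintegral_const_add_sq_le [IsProbabilityMeasure P] (hG : IsSubBrownian P T m fun t => G t)
    (c : ℝ) {t : ℝ} (ht : t ∈ Icc 0 T) :
    ∫⁻ ω, ‖c + G t ω‖ₑ ^ 2 ∂P ≤ 2 * (‖c‖ₑ ^ 2 + m * ENNReal.ofReal T) := by
  have h_sq : ∫⁻ ω, ‖G t ω‖ₑ ^ 2 ∂P ≤ m * ENNReal.ofReal T := by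
    have h_zero := hG.zero ⟨0, le_rfl, ht.1.trans ht.2⟩ rfl
    calc ∫⁻ ω, ‖G t ω‖ₑ ^ 2 ∂P = ∫⁻ ω, ‖G t ω - G 0 ω‖ₑ ^ 2 ∂P := by
          refine lintegral_congr_ae ?_
          filter_upwards [h_zero] with ω hω using by rw [hω, sub_zero]
      _ ≤ m * ENNReal.ofReal (t - 0) := hG.lintegral_sub_sq_le_of_mem_Icc le_rfl ht.1 ht.2
      _ ≤ m * ENNReal.ofReal T := by
          rw [sub_zero]
          gcongr
          exact ht.2
  calc ∫⁻ ω, ‖c + G t ω‖ₑ ^ 2 ∂P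
      ≤ ∫⁻ ω, 2 * (‖c‖ₑ ^ 2 + ‖G t ω‖ₑ ^ 2) ∂P := lintegral_mono fun ω => enorm_add_sq_le _ _
    _ = 2 * (‖c‖ₑ ^ 2 + ∫⁻ ω, ‖G t ω‖ₑ ^ 2 ∂P) := by
        rw [lintegral_const_mul' _ _ (by norm_num), lintegral_add_left measurable_const,
          lintegral_const, measure_univ, mul_one]
    _ ≤ _ := by gcongr

end IsSubBrownian

end Noise

section MomentBound

variable {Ω : Type*} [MeasurableSpace Ω] {P : Measure Ω} {T : ℝ} {m : ℝ≥0∞} {G : ℝ → Ω → ℝ}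

lemma lintegral_enorm_expKernel_zero_sq_le {a : ℝ} (ha : 0 < a) (k : ℕ) :
    ∫⁻ r in Ioi 0, ‖expKernel 0 k a r‖ₑ ^ 2 ≤
      ENNReal.ofReal (2 * expKernelBound 0 k ^ 2 / a) := by
  have h_bdd : ∀ r ∈ Ioi (0 : ℝ), ‖expKernel 0 k a r‖ₑ ≤ ENNReal.ofReal (expKernelBound 0 k) := by
    intro r (hr : 0 < r)
    rw [Real.enorm_eq_ofReal_abs]
    refine ENNReal.ofReal_le_ofReal ((abs_expKernel_le 0 k ha.le hr.le).trans ?_)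
    rw [pow_zero, one_mul]
    exact mul_le_of_le_one_right (expKernelBound_nonneg 0 k)
      (Real.exp_le_one_iff.2 (neg_nonpos.2 (by positivity)))
  have h_meas := (continuous_expKernel 0 k).uncurry_left a |>.measurable
  calc ∫⁻ r in Ioi 0, ‖expKernel 0 k a r‖ₑ ^ 2
      ≤ ∫⁻ r in Ioi 0, ENNReal.ofReal (expKernelBound 0 k) *
          (‖expKernel 0 k a r‖ₑ * ENNReal.ofReal (r ^ 0)) := by
        refine setLIntegral_mono (by fun_prop) fun r hr => ?_
        rw [pow_zero, ENNReal.ofReal_one, mul_one, pow_two]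
        gcongr
        exact h_bdd r hr
    _ ≤ ENNReal.ofReal (expKernelBound 0 k) *
          ENNReal.ofReal (expKernelBound 0 k * (a ^ 0 * (0 ! / (a / 2) ^ (0 + 1)))) := by
        rw [lintegral_const_mul _ (by fun_prop)]
        gcongr
        exact lintegral_enorm_expKernel_mul_le ha 0 k 0
    _ = ENNReal.ofReal (2 * expKernelBound 0 k ^ 2 / a) := by
        rw [← ENNReal.ofReal_mul (expKernelBound_nonneg 0 k)]
        congr 1
        simp only [pow_zero, one_mul, zero_add, pow_one, Nat.factorial_zero, Nat.cast_one]
        field_simp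

lemma measurable_uncurry_volterraDeriv (hG_cont : ∀ ω, Continuous fun t => G t ω)
    (hG_meas : ∀ t, Measurable (G t)) (c : ℝ) (k : ℕ) (a : ℝ) :
    Measurable (fun t ω => volterraDeriv c (fun t => G t ω) k a t).uncurry := by
  refine measurable_uncurry_of_continuous_of_measurable
    (fun ω => continuous_volterraDeriv c k (hG_cont ω) a) fun t => ?_
  have hG : Measurable G.uncurry := measurable_uncurry_of_continuous_of_measurable hG_cont hG_meas
  have h_kernel := (continuous_expKernel 1 k).uncurry_left a |>.measurable
  have h_conv : Measurable fun p : Ω × ℝ =>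
      expKernel 1 k a p.2 * (G (t - p.2) p.1 - G t p.1) :=
    (h_kernel.comp measurable_snd).mul
      ((hG.comp ((measurable_snd.const_sub t).prodMk measurable_fst)).sub
        ((hG_meas t).comp measurable_fst))
  refine ((measurable_const.add (hG_meas t)).mul measurable_const).sub ?_
  simp only [intervalIntegral]
  exact (h_conv.stronglyMeasurable.integral_prod_right.sub
    h_conv.stronglyMeasurable.integral_prod_right).measurable

lemma lintegral_convolution_sq_le [SFinite P] (hG_cont : ∀ ω, Continuous fun t => G t ω)
    (hG_meas : ∀ t, Measurable (G t)) (hG : IsSubBrownian P T m fun t => G t) {a : ℝ} (ha : 0 < a)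
    (k : ℕ) {t : ℝ} (ht : t ∈ Icc 0 T) :
    ∫⁻ ω, ‖∫ r in (0 : ℝ)..t, expKernel 1 k a r * (G (t - r) ω - G t ω)‖ₑ ^ 2 ∂P ≤
      ENNReal.ofReal (8 * expKernelBound 1 k ^ 2 / a) * m := by
  have hG' : Measurable G.uncurry := measurable_uncurry_of_continuous_of_measurable hG_cont hG_meas
  have h_kernel := (continuous_expKernel 1 k).uncurry_left a |>.measurable
  have h_bound (i : ℕ) : ∫⁻ r in Ioc 0 t, ‖expKernel 1 k a r‖ₑ * ENNReal.ofReal (r ^ i) ≤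
      ENNReal.ofReal (expKernelBound 1 k * (a ^ 1 * (i ! / (a / 2) ^ (i + 1)))) :=
    (lintegral_mono_set Ioc_subset_Ioi_self).trans (lintegral_enorm_expKernel_mul_le ha 1 k i)
  have h_incr : ∀ r ∈ Ioc 0 t, ‖expKernel 1 k a r‖ₑ * ∫⁻ ω, ‖G (t - r) ω - G t ω‖ₑ ^ 2 ∂P ≤
      ‖expKernel 1 k a r‖ₑ * ENNReal.ofReal (r ^ 1) * m := by
    intro r hr
    have := hG.lintegral_sub_sq_le_of_mem_Icc (sub_nonneg.2 hr.2) (sub_le_self t hr.1.le) ht.2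
    simp only [enorm_sub_rev (G t _), sub_sub_cancel] at this
    rw [pow_one, mul_assoc, mul_comm (ENNReal.ofReal r)]
    gcongr
  simp only [intervalIntegral.integral_of_le ht.1]
  calc ∫⁻ ω, ‖∫ r in Ioc 0 t, expKernel 1 k a r * (G (t - r) ω - G t ω)‖ₑ ^ 2 ∂P
      ≤ (∫⁻ r in Ioc 0 t, ‖expKernel 1 k a r‖ₑ) * ∫⁻ r in Ioc 0 t, ‖expKernel 1 k a r‖ₑ *
          ∫⁻ ω, ‖G (t - r) ω - G t ω‖ₑ ^ 2 ∂P :=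
        lintegral_enorm_integral_mul_sq_le h_kernel (h := fun r ω => G (t - r) ω - G t ω)
          ((hG'.comp ((measurable_fst.const_sub t).prodMk measurable_snd)).sub
            ((hG_meas t).comp measurable_snd))
    _ ≤ (∫⁻ r in Ioc 0 t, ‖expKernel 1 k a r‖ₑ * ENNReal.ofReal (r ^ 0)) *
          ((∫⁻ r in Ioc 0 t, ‖expKernel 1 k a r‖ₑ * ENNReal.ofReal (r ^ 1)) * m) := by
        refine mul_le_mul' (by simp only [pow_zero, ENNReal.ofReal_one, mul_one, le_refl]) ?_
        rw [← lintegral_mul_const _ (by fun_prop)]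
        exact setLIntegral_mono (by fun_prop) h_incr
    _ ≤ ENNReal.ofReal (expKernelBound 1 k * (a ^ 1 * (0 ! / (a / 2) ^ (0 + 1)))) *
          (ENNReal.ofReal (expKernelBound 1 k * (a ^ 1 * (1 ! / (a / 2) ^ (1 + 1)))) * m) := by
        gcongr <;> exact h_bound _
    _ = ENNReal.ofReal (8 * expKernelBound 1 k ^ 2 / a) * m := by
        have := expKernelBound_nonneg 1 k
        rw [← mul_assoc, ← ENNReal.ofReal_mul (by positivity)]
        congr 2
        simp only [Nat.factorial_zero, Nat.factorial_one, Nat.cast_one]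
        field_simp
        ring

variable [IsProbabilityMeasure P]

lemma lintegral_volterraDeriv_sq_le (hG_cont : ∀ ω, Continuous fun t => G t ω)
    (hG_meas : ∀ t, Measurable (G t)) (hG : IsSubBrownian P T m fun t => G t) (c : ℝ) {a : ℝ}
    (ha : 0 < a) (k : ℕ) {t : ℝ} (ht : t ∈ Icc 0 T) :
    ∫⁻ ω, ‖volterraDeriv c (fun t => G t ω) k a t‖ₑ ^ 2 ∂P ≤
      4 * (‖c‖ₑ ^ 2 + m * ENNReal.ofReal T) * ‖expKernel 0 k a t‖ₑ ^ 2 +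
        2 * (ENNReal.ofReal (8 * expKernelBound 1 k ^ 2 / a) * m) := by
  calc ∫⁻ ω, ‖volterraDeriv c (fun t => G t ω) k a t‖ₑ ^ 2 ∂P
      ≤ ∫⁻ ω, 2 * (‖c + G t ω‖ₑ ^ 2 * ‖expKernel 0 k a t‖ₑ ^ 2 +
          ‖∫ r in (0 : ℝ)..t, expKernel 1 k a r * (G (t - r) ω - G t ω)‖ₑ ^ 2) ∂P := by
        refine lintegral_mono fun ω => ?_
        rw [volterraDeriv, sub_eq_add_neg]
        refine (enorm_add_sq_le _ _).trans_eq ?_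
        rw [enorm_mul, mul_pow, enorm_neg]
    _ = 2 * ((∫⁻ ω, ‖c + G t ω‖ₑ ^ 2 ∂P) * ‖expKernel 0 k a t‖ₑ ^ 2 +
          ∫⁻ ω, ‖∫ r in (0 : ℝ)..t, expKernel 1 k a r * (G (t - r) ω - G t ω)‖ₑ ^ 2 ∂P) := by
        have := hG_meas t
        rw [lintegral_const_mul' _ _ (by norm_num), lintegral_add_left (by fun_prop),
          lintegral_mul_const _ (by fun_prop)]
    _ ≤ 2 * (2 * (‖c‖ₑ ^ 2 + m * ENNReal.ofReal T) * ‖expKernel 0 k a t‖ₑ ^ 2 +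
          ENNReal.ofReal (8 * expKernelBound 1 k ^ 2 / a) * m) := by
        gcongr
        · exact hG.lintegral_const_add_sq_le c ht
        · exact lintegral_convolution_sq_le hG_cont hG_meas hG ha k ht
    _ = _ := by ring

lemma lintegral_lintegral_volterraDeriv_sq_le (hG_cont : ∀ ω, Continuous fun t => G t ω)
    (hG_meas : ∀ t, Measurable (G t)) (hG : IsSubBrownian P T m fun t => G t) (c : ℝ) {a : ℝ}
    (ha : 0 < a) (k : ℕ) :
    ∫⁻ ω, (∫⁻ t in Icc 0 T, ‖volterraDeriv c (fun t => G t ω) k a t‖ₑ ^ 2) ∂P ≤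
      ENNReal.ofReal (16 * (expKernelBound 0 k ^ 2 + expKernelBound 1 k ^ 2) / a) *
        (‖c‖ₑ ^ 2 + m * ENNReal.ofReal T) := by
  set S := ‖c‖ₑ ^ 2 + m * ENNReal.ofReal T
  have h_kernel := (continuous_expKernel 0 k).uncurry_left a |>.measurable
  have h_sq : ∫⁻ t in Icc 0 T, ‖expKernel 0 k a t‖ₑ ^ 2 ≤
      ENNReal.ofReal (2 * expKernelBound 0 k ^ 2 / a) := by
    rw [setLIntegral_congr Ioc_ae_eq_Icc.symm]
    exact (lintegral_mono_set Ioc_subset_Ioi_self).trans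
      (lintegral_enorm_expKernel_zero_sq_le ha k)
  have h_meas := measurable_uncurry_volterraDeriv hG_cont hG_meas c k a
  calc ∫⁻ ω, (∫⁻ t in Icc 0 T, ‖volterraDeriv c (fun t => G t ω) k a t‖ₑ ^ 2) ∂P
      = ∫⁻ t in Icc 0 T, (∫⁻ ω, ‖volterraDeriv c (fun t => G t ω) k a t‖ₑ ^ 2 ∂P) :=
        lintegral_lintegral_swap ((h_meas.comp measurable_swap).enorm.pow_const 2).aemeasurable
    _ ≤ ∫⁻ t in Icc 0 T, (4 * S * ‖expKernel 0 k a t‖ₑ ^ 2 +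
          2 * (ENNReal.ofReal (8 * expKernelBound 1 k ^ 2 / a) * m)) :=
        setLIntegral_mono (by fun_prop) fun t ht =>
          lintegral_volterraDeriv_sq_le hG_cont hG_meas hG c ha k ht
    _ = 4 * S * (∫⁻ t in Icc 0 T, ‖expKernel 0 k a t‖ₑ ^ 2) +
          2 * ENNReal.ofReal (8 * expKernelBound 1 k ^ 2 / a) * (m * ENNReal.ofReal T) := by
        rw [lintegral_add_right _ measurable_const, lintegral_const_mul _ (by fun_prop),
          setLIntegral_const, Real.volume_Icc, sub_zero]
        ring
    _ ≤ 4 * S * ENNReal.ofReal (4 * expKernelBound 0 k ^ 2 / a) +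
          2 * ENNReal.ofReal (8 * expKernelBound 1 k ^ 2 / a) * S := by
        gcongr
        · refine h_sq.trans (ENNReal.ofReal_le_ofReal ?_)
          gcongr
          norm_num
        · exact le_add_self
    _ = _ := by
        rw [mul_right_comm, ← add_mul, ← ENNReal.ofReal_ofNat 4, ← ENNReal.ofReal_ofNat 2,
          ← ENNReal.ofReal_mul (by norm_num), ← ENNReal.ofReal_mul (by norm_num),
          ← ENNReal.ofReal_add (by positivity) (by positivity)]
        congr 2
        ring

end MomentBound

lemma abs_log_pow_le {l₀ l s : ℝ} (hl₀ : 0 < l₀) (hl : l₀ ≤ l) (hs : 0 < s) (n : ℕ) :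
    |Real.log l| ^ n ≤ n ! / s ^ n * Real.exp (2 * s * |Real.log l₀|) * l ^ s := by
  have h_abs : |Real.log l| ≤ Real.log l + 2 * |Real.log l₀| := by
    have h_log := Real.log_le_log hl₀ hl
    have h_neg := neg_abs_le (Real.log l₀)
    exact abs_le.2 ⟨by linarith, by linarith [abs_nonneg (Real.log l₀)]⟩
  have h_exp := Real.pow_div_factorial_le_exp (s * |Real.log l|) (by positivity) n
  calc |Real.log l| ^ n = n ! / s ^ n * ((s * |Real.log l|) ^ n / n !) := by
        rw [mul_pow]
        field_simp
    _ ≤ n ! / s ^ n * Real.exp (s * |Real.log l|) := by gcongr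
    _ ≤ n ! / s ^ n * Real.exp (s * (Real.log l + 2 * |Real.log l₀|)) := by gcongr
    _ = n ! / s ^ n * Real.exp (2 * s * |Real.log l₀|) * l ^ s := by
        rw [Real.rpow_def_of_pos (hl₀.trans_le hl), mul_assoc, ← Real.exp_add]
        congr 2
        ring

section Orthogonal

variable {𝕜 H ι : Type*} [RCLike 𝕜] [NormedAddCommGroup H] [InnerProductSpace 𝕜 H] {u : ι → H}

lemma norm_sum_sq_of_pairwise_orthogonal (hu : Pairwise fun i j => inner 𝕜 (u i) (u j) = 0)
    (s : Finset ι) : ‖∑ j ∈ s, u j‖ ^ 2 = ∑ j ∈ s, ‖u j‖ ^ 2 := by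
  classical
  induction s using Finset.induction_on with
  | empty => simp
  | insert i s hi ih =>
    have h_orth : inner 𝕜 (u i) (∑ j ∈ s, u j) = 0 := by
      rw [inner_sum]
      exact Finset.sum_eq_zero fun j hj => hu (ne_of_mem_of_not_mem hj hi).symm
    rw [Finset.sum_insert hi, Finset.sum_insert hi, ← ih, pow_two, pow_two, pow_two,
      norm_add_sq_eq_norm_sq_add_norm_sq_of_inner_eq_zero _ _ h_orth]

lemma hasSum_norm_sq_of_pairwise_orthogonal {U : H}
    (hu : Pairwise fun i j => inner 𝕜 (u i) (u j) = 0) (hU : HasSum u U) :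
    HasSum (fun j => ‖u j‖ ^ 2) (‖U‖ ^ 2) :=
  ((continuous_norm.pow 2).tendsto U |>.comp hU).congr
    (norm_sum_sq_of_pairwise_orthogonal hu)

lemma summable_of_pairwise_orthogonal [CompleteSpace H]
    (hu : Pairwise fun i j => inner 𝕜 (u i) (u j) = 0) (hs : Summable fun j => ‖u j‖ ^ 2) :
    Summable u := by
  have h_family : OrthogonalFamily 𝕜 (fun j => Submodule.span 𝕜 {u j})
      fun j => (Submodule.span 𝕜 {u j}).subtypeₗᵢ := by
    intro i j hij v w
    obtain ⟨a, ha⟩ := Submodule.mem_span_singleton.1 v.2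
    obtain ⟨b, hb⟩ := Submodule.mem_span_singleton.1 w.2
    simp [← ha, ← hb, inner_smul_left, inner_smul_right, hu hij]
  exact (h_family.summable_iff_norm_sq_summable
    fun j => ⟨u j, Submodule.mem_span_singleton_self (u j)⟩).2 hs

lemma countable_of_orthonormal [TopologicalSpace.SeparableSpace H] (hu : Orthonormal 𝕜 u) :
    Countable ι := by
  have h_disjoint : Pairwise (Function.onFun Disjoint fun i => Metric.ball (u i) (1 / 2)) := by
    intro i j hij
    refine Metric.ball_disjoint_ball ?_
    have h_sq : ‖u i - u j‖ ^ 2 = 2 := by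
      rw [@norm_sub_sq 𝕜, hu.1, hu.1, hu.2 hij]
      norm_num
    rw [dist_eq_norm]
    nlinarith [norm_nonneg (u i - u j)]
  exact h_disjoint.countable_of_isOpen_disjoint (fun i => Metric.isOpen_ball)
    fun i => ⟨u i, Metric.mem_ball_self (by norm_num)⟩

end Orthogonal

section Measurability

variable {Ω X : Type*} [MeasurableSpace Ω] [MeasurableSpace X]

lemma stronglyMeasurable_of_inner {𝕜 H : Type*} [RCLike 𝕜] [NormedAddCommGroup H]
    [InnerProductSpace 𝕜 H] [CompleteSpace H] [TopologicalSpace.SeparableSpace H] {v : Ω → H}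
    (hv : ∀ w, Measurable fun ω => inner 𝕜 w (v ω)) : StronglyMeasurable v := by
  obtain ⟨w, b, -⟩ := exists_hilbertBasis 𝕜 H
  have : Countable w := countable_of_orthonormal b.orthonormal
  refine stronglyMeasurable_of_tendsto (atTop : Filter (Finset w))
    (f := fun s ω => ∑ i ∈ s, inner 𝕜 (b i) (v ω) • b i) (fun s => ?_)
    (tendsto_pi_nhds.2 fun ω => ?_)
  · exact Finset.stronglyMeasurable_fun_sum s fun i _ =>
      (hv (b i)).stronglyMeasurable.smul_const (b i)
  · simpa only [HasSum, b.repr_apply_apply, SummationFilter.unconditional_filter]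
      using b.hasSum_repr (v ω)

lemma stronglyMeasurable_toLp [MeasurableSpace.CountablyGenerated X] {μ : Measure X} [SFinite μ]
    {F : Ω → X → ℝ} (hF : Measurable F.uncurry) (hF_memLp : ∀ ω, MemLp (F ω) 2 μ) :
    StronglyMeasurable fun ω => (hF_memLp ω).toLp (F ω) := by
  have : Fact ((2 : ℝ≥0∞) ≠ ∞) := ⟨ENNReal.ofNat_ne_top⟩
  refine stronglyMeasurable_of_inner (𝕜 := ℝ) fun w => ?_
  have h_inner (ω : Ω) : ⟪w, (hF_memLp ω).toLp (F ω)⟫ = ∫ x, F ω x * w x ∂μ := by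
    rw [L2.inner_def]
    refine integral_congr_ae ?_
    filter_upwards [(hF_memLp ω).coeFn_toLp] with x hx
    rw [hx, RCLike.inner_apply, conj_trivial]
  simp only [h_inner]
  exact (hF.mul ((Lp.stronglyMeasurable w).measurable.comp
    measurable_snd)).stronglyMeasurable.integral_prod_right.measurable

end Measurability

section LpSeries

variable {Ω H : Type*} [MeasurableSpace Ω] {P : Measure Ω} [NormedAddCommGroup H]

lemma lintegral_enorm_sq_eq_eLpNorm (f : Ω → H) : ∫⁻ ω, ‖f ω‖ₑ ^ 2 ∂P = eLpNorm f 2 P ^ 2 := by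
  simpa using (eLpNorm_nnreal_pow_eq_lintegral (f := f) (μ := P) (p := 2) two_ne_zero).symm

lemma lintegral_enorm_sq_Lp (f : Lp H 2 P) : ∫⁻ ω, ‖f ω‖ₑ ^ 2 ∂P = ENNReal.ofReal (‖f‖ ^ 2) := by
  rw [lintegral_enorm_sq_eq_eLpNorm, ENNReal.ofReal_pow (norm_nonneg f), Lp.norm_def,
    ENNReal.ofReal_toReal (Lp.eLpNorm_ne_top f)]

lemma memLp_two_of_lintegral_enorm_sq_ne_top {f : Ω → H} (hf : AEStronglyMeasurable f P)
    (h : ∫⁻ ω, ‖f ω‖ₑ ^ 2 ∂P ≠ ∞) : MemLp f 2 P := by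
  rw [lintegral_enorm_sq_eq_eLpNorm] at h
  exact ⟨hf, lt_top_iff_ne_top.2 fun h_top => h (by simp [h_top])⟩

lemma exists_hasSum_Lp_of_pairwise_orthogonal {𝕜 ι : Type*} [RCLike 𝕜] [InnerProductSpace 𝕜 H]
    [CompleteSpace H] [Countable ι] {u : ι → Lp H 2 P}
    (h_orth : ∀ᵐ ω ∂P, Pairwise fun i j => inner 𝕜 (u i ω) (u j ω) = 0)
    (h_sum : ∑' j, ∫⁻ ω, ‖u j ω‖ₑ ^ 2 ∂P ≠ ∞) :
    ∃ U : Lp H 2 P, HasSum u U ∧ ∀ᵐ ω ∂P, HasSum (fun j => u j ω) (U ω) := by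
  have h_orth_Lp : Pairwise fun i j => inner 𝕜 (u i) (u j) = 0 := by
    intro i j hij
    rw [L2.inner_def]
    refine integral_eq_zero_of_ae ?_
    filter_upwards [h_orth] with ω hω using hω hij
  have h_summable : Summable u := by
    refine summable_of_pairwise_orthogonal h_orth_Lp ?_
    simpa [lintegral_enorm_sq_Lp] using ENNReal.summable_toReal h_sum
  have h_meas (j : ι) : Measurable fun ω => ‖u j ω‖ₑ ^ 2 :=
    (Lp.stronglyMeasurable (u j)).enorm.pow_const 2
  have h_ae_lt_top : ∀ᵐ ω ∂P, ∑' j, ‖u j ω‖ₑ ^ 2 < ∞ :=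
    ae_lt_top (Measurable.tsum h_meas) (by
      rwa [lintegral_tsum fun j => (h_meas j).aemeasurable])
  -- A subsequence of the partial sums converges almost surely to the sum in `Lp`.
  have h_in_measure := tendstoInMeasure_of_tendsto_Lp (by simpa [HasSum] using h_summable.hasSum)
  obtain ⟨F, hF, hF_lim⟩ := h_in_measure.exists_seq_tendsto_ae'
  have h_coe : ∀ᵐ ω ∂P, ∀ n, (∑ j ∈ F n, u j : Lp H 2 P) ω = ∑ j ∈ F n, u j ω :=
    ae_all_iff.2 fun n => Lp.coeFn_fun_finsetSum _ _
  refine ⟨∑' j, u j, h_summable.hasSum, ?_⟩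
  filter_upwards [h_orth, h_ae_lt_top, hF_lim, h_coe] with ω h_orth h_lt_top hF_lim h_coe
  have h_summable_ω : Summable fun j => u j ω := by
    refine summable_of_pairwise_orthogonal h_orth ?_
    simpa using ENNReal.summable_toReal h_lt_top.ne
  simp only [h_coe] at hF_lim
  rw [tendsto_nhds_unique hF_lim (h_summable_ω.hasSum.comp hF)]
  exact h_summable_ω.hasSum

end LpSeries

section Tensor

variable {X Y : Type*} [MeasurableSpace X] [MeasurableSpace Y] {ν : Measure X} {κ : Measure Y}

lemma memLp_two_mul_prod {f : Y → ℝ} {v : X → ℝ} (hv : MemLp v 2 ν) (hf : MemLp f 2 κ) :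
    MemLp (fun p : X × Y => f p.2 * v p.1) 2 (ν.prod κ) := by
  have h_meas : AEStronglyMeasurable (fun p : X × Y => f p.2 * v p.1) (ν.prod κ) :=
    hf.1.comp_snd.mul hv.1.comp_fst
  rw [memLp_two_iff_integrable_sq h_meas]
  simpa only [mul_pow, mul_comm] using hv.integrable_sq.mul_prod hf.integrable_sq

/-- The elementary tensor `v ⊗ f` of `v ∈ L²(ν)` and a square integrable function `f`, realized as
the function `(x, y) ↦ f y * v x` in `L²(ν ⊗ κ)`. -/
def tensorLp (v : Lp ℝ 2 ν) {f : Y → ℝ} (hf : MemLp f 2 κ) : Lp ℝ 2 (ν.prod κ) :=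
  (memLp_two_mul_prod (Lp.memLp v) hf).toLp _

lemma coeFn_tensorLp (v : Lp ℝ 2 ν) {f : Y → ℝ} (hf : MemLp f 2 κ) :
    tensorLp v hf =ᵐ[ν.prod κ] fun p => f p.2 * v p.1 :=
  MemLp.coeFn_toLp _

variable [SFinite ν] [SFinite κ]

lemma inner_tensorLp (v w : Lp ℝ 2 ν) {f g : Y → ℝ} (hf : MemLp f 2 κ) (hg : MemLp g 2 κ) :
    ⟪tensorLp v hf, tensorLp w hg⟫ = ⟪v, w⟫ * ∫ y, f y * g y ∂κ := by
  rw [L2.inner_def, L2.inner_def, ← integral_prod_mul]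
  refine integral_congr_ae ?_
  filter_upwards [coeFn_tensorLp v hf, coeFn_tensorLp w hg] with p hv hw
  simp only [hv, hw, RCLike.inner_apply, conj_trivial]
  ring

lemma ofReal_norm_sq_tensorLp {v : Lp ℝ 2 ν} (hv : ‖v‖ = 1) {f : Y → ℝ} (hf : MemLp f 2 κ) :
    ENNReal.ofReal (‖tensorLp v hf‖ ^ 2) = ∫⁻ y, ENNReal.ofReal (f y ^ 2) ∂κ := by
  rw [← real_inner_self_eq_norm_sq, inner_tensorLp, real_inner_self_eq_norm_sq, hv, one_pow,
    one_mul]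
  simp only [← pow_two]
  exact ofReal_integral_eq_lintegral_ofReal hf.integrable_sq (ae_of_all _ fun y => sq_nonneg _)

lemma enorm_sq_tensorLp {v : Lp ℝ 2 ν} (hv : ‖v‖ = 1) {f : Y → ℝ} (hf : MemLp f 2 κ) :
    ‖tensorLp v hf‖ₑ ^ 2 = ∫⁻ y, ‖f y‖ₑ ^ 2 ∂κ := by
  rw [← ofReal_norm, ← ENNReal.ofReal_pow (norm_nonneg _), ofReal_norm_sq_tensorLp hv]
  refine lintegral_congr fun y => ?_
  rw [← ofReal_norm, ← ENNReal.ofReal_pow (norm_nonneg _), Real.norm_eq_abs, sq_abs]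

lemma stronglyMeasurable_tensorLp [MeasurableSpace.CountablyGenerated X]
    [MeasurableSpace.CountablyGenerated Y] {Ω : Type*} [MeasurableSpace Ω] (v : Lp ℝ 2 ν)
    {F : Ω → Y → ℝ} (hF : Measurable F.uncurry) (hF_memLp : ∀ ω, MemLp (F ω) 2 κ) :
    StronglyMeasurable fun ω => tensorLp v (hF_memLp ω) :=
  stronglyMeasurable_toLp (F := fun ω (p : X × Y) => F ω p.2 * v p.1)
    ((hF.comp (measurable_fst.prodMk measurable_snd.snd)).mul
      ((Lp.stronglyMeasurable v).measurable.comp measurable_snd.fst)) _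

variable [MeasurableSpace.CountablyGenerated X] [MeasurableSpace.CountablyGenerated Y]
  {Ω ι : Type*} [MeasurableSpace Ω] {P : Measure Ω} [Countable ι] {e : ι → Lp ℝ 2 ν}
  {F : ι → Ω → Y → ℝ}

lemma exists_hasSum_tensorLp (he : Orthonormal ℝ e) (hF : ∀ j, Measurable (F j).uncurry)
    (hF_memLp : ∀ j ω, MemLp (F j ω) 2 κ)
    (hF_sum : ∑' j, ∫⁻ ω, (∫⁻ y, ‖F j ω y‖ₑ ^ 2 ∂κ) ∂P ≠ ∞) :
    ∃ (u : ι → Lp (Lp ℝ 2 (ν.prod κ)) 2 P) (U : Lp (Lp ℝ 2 (ν.prod κ)) 2 P),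
      (∀ᵐ ω ∂P, ∀ j, u j ω = tensorLp (e j) (hF_memLp j ω)) ∧
      HasSum u U ∧ ∀ᵐ ω ∂P, HasSum (fun j => u j ω) (U ω) := by
  have h_norm (j : ι) : ∫⁻ ω, ‖tensorLp (e j) (hF_memLp j ω)‖ₑ ^ 2 ∂P =
      ∫⁻ ω, (∫⁻ y, ‖F j ω y‖ₑ ^ 2 ∂κ) ∂P :=
    lintegral_congr fun ω => enorm_sq_tensorLp (he.1 j) (hF_memLp j ω)
  have h_memLp (j : ι) : MemLp (fun ω => tensorLp (e j) (hF_memLp j ω)) 2 P :=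
    memLp_two_of_lintegral_enorm_sq_ne_top
      (stronglyMeasurable_tensorLp (e j) (hF j) (hF_memLp j)).aestronglyMeasurable
      (h_norm j ▸ ENNReal.ne_top_of_tsum_ne_top hF_sum j)
  have h_coe : ∀ᵐ ω ∂P, ∀ j, (h_memLp j).toLp _ ω = tensorLp (e j) (hF_memLp j ω) :=
    ae_all_iff.2 fun j => (h_memLp j).coeFn_toLp
  obtain ⟨U, hU, hU_ae⟩ := exists_hasSum_Lp_of_pairwise_orthogonal (𝕜 := ℝ)
    (u := fun j => (h_memLp j).toLp _) (by
      filter_upwards [h_coe] with ω hω i j hij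
      rw [hω, hω, inner_tensorLp, he.2 hij, zero_mul]) (by
      convert hF_sum using 3 with j
      rw [← h_norm]
      refine lintegral_congr_ae ?_
      filter_upwards [h_coe] with ω hω
      rw [hω])
  exact ⟨_, U, h_coe, hU, hU_ae⟩

lemma exists_hasSum_mul_of_ae_eq {G : ι → Ω → Y → ℝ} (he : Orthonormal ℝ e)
    (hF : ∀ j, Measurable (F j).uncurry) (hF_memLp : ∀ j ω, MemLp (F j ω) 2 κ)
    (hF_sum : ∑' j, ∫⁻ ω, (∫⁻ y, ‖F j ω y‖ₑ ^ 2 ∂κ) ∂P ≠ ∞)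
    (hG : ∀ᵐ ω ∂P, ∀ j, G j ω =ᵐ[κ] F j ω) :
    ∃ (u : ι → Lp (Lp ℝ 2 (ν.prod κ)) 2 P) (U : Lp (Lp ℝ 2 (ν.prod κ)) 2 P),
      (∀ j, ∀ᵐ ω ∂P, u j ω =ᵐ[ν.prod κ] fun p => G j ω p.2 * e j p.1) ∧
      HasSum u U ∧
      (∀ᵐ ω ∂P, HasSum (fun j => u j ω) (U ω)) ∧
      ∀ᵐ ω ∂P, ENNReal.ofReal (‖U ω‖ ^ 2) = ∑' j, ∫⁻ y, ENNReal.ofReal (G j ω y ^ 2) ∂κ ∧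
        ∑' j, ∫⁻ y, ENNReal.ofReal (G j ω y ^ 2) ∂κ < ∞ := by
  obtain ⟨u, U, hu, hU, hU_ae⟩ := exists_hasSum_tensorLp he hF hF_memLp hF_sum
  refine ⟨u, U, fun j => ?_, hU, hU_ae, ?_⟩
  · filter_upwards [hu, hG] with ω hu hG
    rw [hu j]
    filter_upwards [coeFn_tensorLp (e j) (hF_memLp j ω),
      Measure.quasiMeasurePreserving_snd.ae (hG j)] with p hp hGp
    rw [hp, hGp]
  · filter_upwards [hu, hU_ae, hG] with ω hu hU_ae hG
    have h_orth : Pairwise fun i j => ⟪u i ω, u j ω⟫ = 0 := fun i j hij => by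
      simp only [hu, inner_tensorLp, he.2 hij, zero_mul]
    have h_term (j : ι) :
        ENNReal.ofReal (‖u j ω‖ ^ 2) = ∫⁻ y, ENNReal.ofReal (G j ω y ^ 2) ∂κ := by
      rw [hu, ofReal_norm_sq_tensorLp (he.1 j)]
      refine lintegral_congr_ae ?_
      filter_upwards [hG j] with y hy
      rw [hy]
    have h_parseval := hasSum_norm_sq_of_pairwise_orthogonal h_orth hU_ae
    have h_norm : ENNReal.ofReal (‖U ω‖ ^ 2) = ∑' j, ∫⁻ y, ENNReal.ofReal (G j ω y ^ 2) ∂κ := by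
      simp only [← h_term, ← h_parseval.tsum_eq]
      exact ENNReal.ofReal_tsum_of_nonneg (fun j => sq_nonneg _) h_parseval.summable
    exact ⟨h_norm, h_norm ▸ ENNReal.ofReal_lt_top⟩

end Tensor

section Modes

variable {H : Type*} [NormedAddCommGroup H] [InnerProductSpace ℝ H]

lemma exists_pos_le_eigenvalue [CompleteSpace H] {L : H →ₗ.[ℝ] H} (hL : IsDiffusionOperator L)
    {e : HilbertBasis ℕ ℝ H} {lam : ℕ → ℝ} (he : IsEigenbasis L e lam) :
    ∃ l₀ : ℝ, 0 < l₀ ∧ ∀ j, l₀ ≤ lam j := by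
  obtain ⟨K, -, hK, -⟩ := hL.compact_inverse
  refine ⟨1 / (‖K‖ + 1), by positivity, fun j => ?_⟩
  obtain ⟨h_mem, h_eigen⟩ := he j
  have h_unit : ‖e j‖ = 1 := e.orthonormal.1 j
  have h_ne : (⟨e j, h_mem⟩ : L.domain) ≠ 0 := fun h_zero => by
    simp [show e j = 0 from congrArg Subtype.val h_zero] at h_unit
  have h_pos : 0 < lam j := by
    simpa [h_eigen, real_inner_smul_left, h_unit] using hL.positive _ h_ne
  have h_inv : lam j • K (e j) = e j := by
    rw [← map_smul, ← h_eigen]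
    exact hK ⟨e j, h_mem⟩
  have h_norm : lam j * ‖K (e j)‖ = 1 := by
    rw [← h_unit, ← abs_of_pos h_pos, ← Real.norm_eq_abs, ← norm_smul, h_inv, h_unit]
  have h_bdd : ‖K (e j)‖ ≤ ‖K‖ + 1 := (K.unit_le_opNorm _ h_unit.le).trans (by linarith)
  rw [div_le_iff₀ (by positivity)]
  exact h_norm.ge.trans (mul_le_mul_of_nonneg_left h_bdd h_pos.le)

lemma IsCovariance.inner_eq {Q : H →L[ℝ] H} {e : HilbertBasis ℕ ℝ H} {mu : ℕ → ℝ}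
    (hQ : IsCovariance Q e mu) (j : ℕ) : ⟪Q (e j), e j⟫ = mu j := by
  rw [hQ.eigen, real_inner_smul_left, real_inner_self_eq_norm_sq, e.orthonormal.1 j, one_pow,
    mul_one]

lemma IsCovariance.summable {Q : H →L[ℝ] H} {e : HilbertBasis ℕ ℝ H} {mu : ℕ → ℝ}
    (hQ : IsCovariance Q e mu) : Summable mu := by
  simpa only [hQ.inner_eq] using hQ.finite_trace

lemma lintegral_enorm_sq_gaussianReal (v : ℝ≥0) : ∫⁻ x, ‖x‖ₑ ^ 2 ∂(gaussianReal 0 v) = v := by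
  have h_variance := ofReal_variance (memLp_id_gaussianReal (μ := 0) (v := v) 2)
  simpa [evariance] using h_variance.symm

variable {Ω : Type*} [MeasurableSpace Ω] {P : Measure Ω} {T : ℝ}

lemma IsQWiener.isSubBrownian_inner {Q : H →L[ℝ] H} {W : Icc (0 : ℝ) T → Ω → H}
    (hW : IsQWiener P T Q W) (h : H) :
    IsSubBrownian P T (ENNReal.ofReal ⟪Q h, h⟫) fun t ω => ⟪W t ω, h⟫ where
  measurable t := ((hW.stronglyMeasurable t).inner stronglyMeasurable_const).measurable
  zero t ht := by filter_upwards [hW.zero t ht] with ω hω using by rw [hω, inner_zero_left]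
  continuous_paths := by
    filter_upwards [hW.continuous_paths] with ω hω using hω.inner continuous_const
  lintegral_sub_sq_le s t hst := by
    have h_meas : Measurable fun ω => ⟪W t ω - W s ω, h⟫ :=
      (((hW.stronglyMeasurable t).sub (hW.stronglyMeasurable s)).inner
        stronglyMeasurable_const).measurable
    simp only [← inner_sub_left]
    rw [← lintegral_map (f := fun x : ℝ => ‖x‖ₑ ^ 2) (by fun_prop) h_meas,
      hW.gaussian_increments s t hst h, lintegral_enorm_sq_gaussianReal, mul_comm]
    exact (ENNReal.ofReal_mul' (sub_nonneg.2 hst)).le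

variable {e : HilbertBasis ℕ ℝ H} {lam mu : ℕ → ℝ} {W : Icc (0 : ℝ) T → Ω → H} {y₀ : H}
  {y : ℕ → ℝ → ℝ → Ω → ℝ}

lemma IsSubBrownian.sqrt_mul_modeBM {m : ℝ≥0∞} {j : ℕ}
    (hW : IsSubBrownian P T m fun t ω => ⟪W t ω, e j⟫) :
    IsSubBrownian P T m fun t ω => √(mu j) * modeBM e mu W j t ω := by
  have h_ratio : ‖√(mu j) / √(mu j)‖ₑ ≤ 1 := by
    rw [Real.enorm_of_nonneg (by positivity), ENNReal.ofReal_le_one]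
    exact div_self_le_one _
  convert hW.const_mul h_ratio using 3 with t ω
  rw [modeBM]
  ring

lemma IsModeSolution.exists_eq_volterraDeriv (hy : IsModeSolution P T e lam mu W y₀ y)
    (hT : 0 ≤ T) {m : ℕ → ℝ≥0∞} (hW : ∀ j, IsSubBrownian P T (m j) fun t ω => ⟪W t ω, e j⟫) :
    ∃ G : ℕ → ℝ → Ω → ℝ, (∀ j ω, Continuous fun t => G j t ω) ∧ (∀ j t, Measurable (G j t)) ∧
      (∀ j, IsSubBrownian P T (m j) fun t => G j t) ∧
      ∀ᵐ ω ∂P, ∀ j, ∀ t ∈ Icc 0 T, ∀ s : ℝ, 0 < s →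
        y j s t ω = volterraDeriv ⟪y₀, e j⟫ (fun t => G j t ω) 0 (lam j ^ s) t := by
  choose G hG_cont hG_meas hG hG_eq using
    fun j => (hW j).sqrt_mul_modeBM (mu := mu).exists_modification hT
  refine ⟨G, hG_cont, hG_meas, hG, ?_⟩
  filter_upwards [hy, ae_all_iff.2 hG_eq] with ω hω hG_eq j t ht s hs
  obtain ⟨h_cont, h_eq⟩ := hω j s hs
  refine eq_volterraDeriv_zero (hG_cont j ω).continuousOn h_cont (fun t ht => ?_) ht
  rw [h_eq ⟨t, ht⟩, ← hG_eq]

end Modes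

lemma modeDeriv_eq_volterraDeriv {l c : ℝ} (hl : 0 < l) {g : ℝ → ℝ} (hg : Continuous g)
    {Ω : Type*} {y : ℕ → ℝ → ℝ → Ω → ℝ} {j : ℕ} {t : ℝ} {ω : Ω}
    (h_eq : ∀ s : ℝ, 0 < s → y j s t ω = volterraDeriv c g 0 (l ^ s) t) (k : ℕ) {s : ℝ}
    (hs : 0 < s) : modeDeriv y k j s t ω = Real.log l ^ k * volterraDeriv c g k (l ^ s) t := by
  have h_near : (fun r => y j r t ω) =ᶠ[𝓝 s] fun r => volterraDeriv c g 0 (l ^ r) t := by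
    filter_upwards [Ioi_mem_nhds hs] with r hr using h_eq r hr
  rw [modeDeriv, h_near.iteratedDeriv_eq, iteratedDeriv_volterraDeriv_rpow c k hl hg]

lemma memLp_two_restrict_Icc_of_continuous {f : ℝ → ℝ} (hf : Continuous f) (a b : ℝ) :
    MemLp f 2 (volume.restrict (Icc a b)) :=
  (memLp_two_iff_integrable_sq hf.aestronglyMeasurable).2 (hf.pow 2).integrableOn_Icc

lemma enorm_log_pow_sq_mul_ofReal_div_le {l₀ l s C : ℝ} (hl₀ : 0 < l₀) (hl : l₀ ≤ l) (hs : 0 < s)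
    (hC : 0 ≤ C) (k : ℕ) :
    ‖Real.log l ^ k‖ₑ ^ 2 * ENNReal.ofReal (C / l ^ s) ≤
      ENNReal.ofReal ((2 * k) ! / s ^ (2 * k) * Real.exp (2 * s * |Real.log l₀|) * C) := by
  have hl_pos : 0 < l ^ s := Real.rpow_pos_of_pos (hl₀.trans_le hl) s
  rw [← enorm_pow, ← pow_mul, mul_comm k, ← ofReal_norm, norm_pow, Real.norm_eq_abs,
    ← ENNReal.ofReal_mul (by positivity)]
  refine ENNReal.ofReal_le_ofReal ?_
  rw [mul_div_assoc', div_le_iff₀ hl_pos, mul_right_comm]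
  exact mul_le_mul_of_nonneg_right (abs_log_pow_le hl₀ hl hs (2 * k)) hC

lemma tsum_lintegral_log_pow_mul_volterraDeriv_ne_top {Ω ι : Type*} [MeasurableSpace Ω]
    {P : Measure Ω} [IsProbabilityMeasure P] {T l₀ s : ℝ} {c l mu : ι → ℝ} {G : ι → ℝ → Ω → ℝ}
    (hG_cont : ∀ j ω, Continuous fun t => G j t ω) (hG_meas : ∀ j t, Measurable (G j t))
    (hG : ∀ j, IsSubBrownian P T (ENNReal.ofReal (mu j)) fun t => G j t) (hl₀ : 0 < l₀)
    (hl : ∀ j, l₀ ≤ l j) (hs : 0 < s) (hc : Summable fun j => ‖c j‖ ^ 2) (hmu : Summable mu)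
    (k : ℕ) :
    ∑' j, ∫⁻ ω, (∫⁻ t in Icc 0 T,
      ‖Real.log (l j) ^ k * volterraDeriv (c j) (fun t => G j t ω) k (l j ^ s) t‖ₑ ^ 2) ∂P ≠ ∞ := by
  set C : ℝ := 16 * (expKernelBound 0 k ^ 2 + expKernelBound 1 k ^ 2)
  let K : ℝ≥0∞ := ENNReal.ofReal ((2 * k) ! / s ^ (2 * k) * Real.exp (2 * s * |Real.log l₀|) * C)
  let S (j : ι) : ℝ≥0∞ := ‖c j‖ₑ ^ 2 + ENNReal.ofReal (mu j) * ENNReal.ofReal T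
  have h_term (j : ι) : ∫⁻ ω, (∫⁻ t in Icc 0 T,
      ‖Real.log (l j) ^ k * volterraDeriv (c j) (fun t => G j t ω) k (l j ^ s) t‖ₑ ^ 2) ∂P ≤
        K * S j := by
    simp only [enorm_mul, mul_pow, lintegral_const_mul' _ _ (ENNReal.pow_ne_top enorm_ne_top)]
    calc _ ≤ ‖Real.log (l j) ^ k‖ₑ ^ 2 * (ENNReal.ofReal (C / l j ^ s) * S j) :=
          mul_le_mul_right (lintegral_lintegral_volterraDeriv_sq_le (hG_cont j) (hG_meas j) (hG j)
            (c j) (Real.rpow_pos_of_pos (hl₀.trans_le (hl j)) s) k) _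
      _ ≤ K * S j := by
          rw [← mul_assoc]
          exact mul_le_mul' (enorm_log_pow_sq_mul_ofReal_div_le hl₀ (hl j) hs (by positivity) k)
            le_rfl
  have hc_tsum : ∑' j, ‖c j‖ₑ ^ 2 ≠ ∞ := by
    simpa only [ENNReal.ofReal_pow (norm_nonneg _), ofReal_norm] using hc.tsum_ofReal_ne_top
  refine ne_top_of_le_ne_top ?_ (ENNReal.tsum_le_tsum h_term)
  rw [ENNReal.tsum_mul_left, ENNReal.tsum_add, ENNReal.tsum_mul_right]
  exact ENNReal.mul_ne_top ENNReal.ofReal_ne_top (ENNReal.add_ne_top.2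
    ⟨hc_tsum, ENNReal.mul_ne_top hmu.tsum_ofReal_ne_top ENNReal.ofReal_ne_top⟩)

theorem mainTheorem5_general {X : Type*} [MeasurableSpace X]
    [MeasurableSpace.CountablyGenerated X] {ν : Measure X} [SFinite ν] {T : ℝ} (hT : 0 ≤ T)
    {e : HilbertBasis ℕ ℝ (Lp ℝ 2 ν)} {lam mu : ℕ → ℝ} {l₀ : ℝ} (hl₀ : 0 < l₀)
    (hlam : ∀ j, l₀ ≤ lam j) (hmu : Summable mu) {Ω : Type*} [MeasurableSpace Ω] {P : Measure Ω}
    [IsProbabilityMeasure P] {W : Icc (0 : ℝ) T → Ω → Lp ℝ 2 ν}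
    (hW : ∀ j, IsSubBrownian P T (ENNReal.ofReal (mu j)) fun t ω => ⟪W t ω, e j⟫)
    {y₀ : Lp ℝ 2 ν} {y : ℕ → ℝ → ℝ → Ω → ℝ} (hy : IsModeSolution P T e lam mu W y₀ y) :
    (∀ᵐ ω ∂P, ∀ j, ∀ t ∈ Icc (0 : ℝ) T,
      ContDiffOn ℝ (⊤ : ℕ∞) (fun s => y j s t ω) (Ioi 0)) ∧
    ∀ s : ℝ, 0 < s → ∀ k : ℕ,
      ∃ (u : ℕ → Lp (Lp ℝ 2 (ν.prod (volume.restrict (Icc (0 : ℝ) T)))) 2 P)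
        (U : Lp (Lp ℝ 2 (ν.prod (volume.restrict (Icc (0 : ℝ) T)))) 2 P),
        (∀ j, ∀ᵐ ω ∂P, u j ω =ᵐ[ν.prod (volume.restrict (Icc (0 : ℝ) T))]
          fun p => modeDeriv y k j s p.2 ω * e j p.1) ∧
        HasSum u U ∧
        (∀ᵐ ω ∂P, HasSum (fun j => u j ω) (U ω)) ∧
        ∀ᵐ ω ∂P,
          ENNReal.ofReal (‖U ω‖ ^ 2) =
            ∑' j, ∫⁻ t in Icc (0 : ℝ) T, ENNReal.ofReal (modeDeriv y k j s t ω ^ 2) ∧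
          ∑' j, ∫⁻ t in Icc (0 : ℝ) T, ENNReal.ofReal (modeDeriv y k j s t ω ^ 2) < ∞ := by
  have hlam_pos (j : ℕ) : 0 < lam j := hl₀.trans_le (hlam j)
  obtain ⟨G, hG_cont, hG_meas, hG, hyG⟩ := hy.exists_eq_volterraDeriv hT hW
  refine ⟨?_, fun s hs k => ?_⟩
  · filter_upwards [hyG] with ω hω j t ht
    exact (contDiff_volterraDeriv_rpow _ (hlam_pos j) (hG_cont j ω) t).contDiffOn.congr (hω j t ht)
  let F (j : ℕ) (ω : Ω) (t : ℝ) : ℝ :=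
    Real.log (lam j) ^ k * volterraDeriv ⟪y₀, e j⟫ (fun t => G j t ω) k (lam j ^ s) t
  have hF_meas (j : ℕ) : Measurable (F j).uncurry :=
    ((measurable_uncurry_volterraDeriv (hG_cont j) (hG_meas j) _ k _).comp
      measurable_swap).const_mul _
  have hF_memLp (j : ℕ) (ω : Ω) : MemLp (F j ω) 2 (volume.restrict (Icc 0 T)) :=
    memLp_two_restrict_Icc_of_continuous
      ((continuous_volterraDeriv _ k (hG_cont j ω) _).const_mul _) 0 T
  have h_deriv : ∀ᵐ ω ∂P, ∀ j,
      (fun t => modeDeriv y k j s t ω) =ᵐ[volume.restrict (Icc 0 T)] F j ω := by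
    filter_upwards [hyG] with ω hω j
    filter_upwards [ae_restrict_mem measurableSet_Icc] with t ht
    exact modeDeriv_eq_volterraDeriv (hlam_pos j) (hG_cont j ω) (hω j t ht) k hs
  have h_coeff : Summable fun j => ‖⟪y₀, e j⟫‖ ^ 2 := by
    simpa only [real_inner_comm] using e.orthonormal.inner_products_summable y₀
  have h_sum : ∑' j, ∫⁻ ω, (∫⁻ t in Icc 0 T, ‖F j ω t‖ₑ ^ 2) ∂P ≠ ∞ :=
    tsum_lintegral_log_pow_mul_volterraDeriv_ne_top hG_cont hG_meas hG hl₀ hlam hs h_coeff hmu k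
  exact exists_hasSum_mul_of_ae_eq (F := F) (G := fun j ω t => modeDeriv y k j s t ω)
    e.orthonormal hF_meas hF_memLp h_sum h_deriv

end FractionalSPDE

end

open FractionalSPDE in
theorem mainTheorem5
    {E : Type*} [NormedAddCommGroup E] [InnerProductSpace ℝ E] [FiniteDimensional ℝ E]
    [MeasurableSpace E] [BorelSpace E]
    (D : Set E) (hD_open : IsOpen D) (hD_bdd : Bornology.IsBounded D)
    (T : ℝ) (hT : 0 < T)
    (L : L2D D →ₗ.[ℝ] L2D D) (hL : IsDiffusionOperator L)
    (e : HilbertBasis ℕ ℝ (L2D D)) (lam : ℕ → ℝ) (he : IsEigenbasis L e lam)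
    (Q : L2D D →L[ℝ] L2D D) (mu : ℕ → ℝ) (hQ : IsCovariance Q e mu)
    {Ω : Type*} [MeasurableSpace Ω] (P : Measure Ω) [IsProbabilityMeasure P]
    (W : Icc (0 : ℝ) T → Ω → L2D D) (hW : IsQWiener P T Q W)
    (y₀ : L2D D)
    (y : ℕ → ℝ → ℝ → Ω → ℝ) (hy : IsModeSolution P T e lam mu W y₀ y) :
    -- the modes are almost surely twice continuously differentiable in the exponent
    (∀ᵐ ω ∂P, ∀ j, ∀ t ∈ Icc (0 : ℝ) T, ContDiffOn ℝ 2 (fun s => y j s t ω) (Ioi 0)) ∧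
    -- first (`k = 1`) and second (`k = 2`) derivative of the solution at an exponent `s > 0`
    ∀ s : ℝ, 0 < s → ∀ k : ℕ, (k = 1 ∨ k = 2) →
      ∃ (u : ℕ → Lp (L2DT D T) 2 P) (U : Lp (L2DT D T) 2 P),
        -- `u j` is the term `∂_s^k y_j(s, ·) e_j` of the series
        (∀ j, ∀ᵐ ω ∂P, (u j ω : E × ℝ → ℝ) =ᵐ[cylMeasure D T]
          fun p => modeDeriv y k j s p.2 ω * (e j : E → ℝ) p.1) ∧
        -- the series converges in `L²(Ω, L²(D × [0, T]))`, and `U` is its sum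
        HasSum u U ∧
        -- almost surely, it converges in `L²(D × [0, T])` to `U ω`
        (∀ᵐ ω ∂P, HasSum (fun j => u j ω) (U ω)) ∧
        -- almost surely, the squared `L²(D × [0, T])`-norm of the sum is finite
        (∀ᵐ ω ∂P,
          ENNReal.ofReal (‖U ω‖ ^ 2) =
            ∑' j, ∫⁻ t in Icc (0 : ℝ) T, ENNReal.ofReal (modeDeriv y k j s t ω ^ 2) ∧
          ∑' j, ∫⁻ t in Icc (0 : ℝ) T, ENNReal.ofReal (modeDeriv y k j s t ω ^ 2) < ∞) := by
  obtain ⟨l₀, hl₀, hlam⟩ := exists_pos_le_eigenvalue hL he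
  have hW_mode (j : ℕ) : IsSubBrownian P T (ENNReal.ofReal (mu j)) fun t ω => ⟪W t ω, e j⟫ :=
    hQ.inner_eq j ▸ hW.isSubBrownian_inner (e j)
  obtain ⟨h_smooth, h_series⟩ := mainTheorem5_general hT.le hl₀ hlam hQ.summable hW_mode hy
  exact ⟨h_smooth.mono fun ω hω j t ht => contDiffOn_infty.1 (hω j t ht) 2,
    fun s hs k _ => h_series s hs k⟩
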